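/- A plane partition (3D partition) is an array $\pi=(\pi_{i,j})_{i,j\ge 0}$ of non-negative integers, only finitely many of them nonzero, with $\pi_{i+1,j}\le \pi_{i,j}$ and $\pi_{i,j+1}\le \pi_{i,j}$ for all $i,j$; its number of boxes is $|\pi|=\sum_{i,j}\pi_{i,j}$. **Theorem (MacMahon's formula).** For every $n\ge 0$ the number $p_n$ of plane partitions with exactly $n$ boxes is finite. Moreover, in the ring $K[[q]]$ of formal power series over a field $K$ (for instance $K=\mathbb{C}$), with its $q$-adic topology, the sum over all plane partitions and the infinite product below converge, both unconditionally, and $$\sum_{\pi\ \text{plane partition}} q^{|\pi|}=\sum_{n\ge 0}p_n q^n=\prod_{n=1}^{\infty}\frac{1}{(1-q^n)^n}.$$ The first coefficients are $p_0=1$, $p_1=1$, $p_2=3$, $p_3=6$, so that the series begins $1+q+3q^2+6q^3+\cdots$. -/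

import Mathlib

open scoped PowerSeries PowerSeries.WithPiTopology

/-- A plane partition (3D partition): a matrix of natural numbers with finitely many nonzero
entries (equivalently, zero outside a sufficiently large square), weakly decreasing in both
directions. The entry at `(i, j)` is the height of the stack of unit boxes above `(i, j)`. -/
@[ext]
structure PlanePartition where
  /-- The height of the stack above each point. -/
  entry : ℕ × ℕ →₀ ℕ
  entry_succ_left_le : ∀ i j : ℕ, entry (i + 1, j) ≤ entry (i, j)
  entry_succ_right_le : ∀ i j : ℕ, entry (i, j + 1) ≤ entry (i, j)

/-- The number of boxes of a plane partition: the sum of all its entries. -/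
def PlanePartition.boxes (π : PlanePartition) : ℕ :=
  ∑ c ∈ π.entry.support, π.entry c

/-- The number of plane partitions with exactly `n` boxes. -/
noncomputable def planePartitionCount (n : ℕ) : ℕ :=
  Nat.card {π : PlanePartition // π.boxes = n}

/-- The power series whose coefficient at `n` is the number of plane partitions with `n` boxes. -/
noncomputable def planePartitionSeries (K : Type*) [Field K] : K⟦X⟧ :=
  PowerSeries.mk fun n ↦ (planePartitionCount n : K)

/-! Read along its diagonals, a plane partition in an N × N square is a pair of chains of
interlacing sequences running from the main diagonal down to 0. The engine is a local move,
`toggleEquiv`: a common upper neighbour ν of a and b is traded for a common lower neighbour κ and a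
natural number n, with |ν| + |κ| = |a| + |b| + n. This is a bijective form of the commutation of
vertex operators. Pushing one upward step through a whole chain (`weightEquiv_sigma_interlaces`)
releases one number per step. Doing so for every step of the other chain
(`InterlacingChain.weightEquiv_matrix`) leaves an arbitrary N × N matrix m, and the number of boxes
becomes ∑ m i j * (i + j + 1).

Hence the square has generating series ∏ 1/(1 - q^(i+j+1)). Cells outside the n-square do not affect
coefficient n, so the product over all cells converges to the plane partition series. Grouping the n
cells with i + j + 1 = n gives MacMahon's product. -/

/-! ### Weight-preserving bijections -/

/-- Two weighted types are weight-equivalent if some bijection between them preserves weights. -/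
def WeightEquiv {α β : Type*} (w : α → ℕ) (v : β → ℕ) : Prop :=
  ∃ e : α ≃ β, ∀ a, v (e a) = w a

namespace WeightEquiv

variable {α β γ : Type*} {w : α → ℕ} {v : β → ℕ} {u : γ → ℕ}

theorem of_equiv (e : α ≃ β) (h : ∀ a, v (e a) = w a) : WeightEquiv w v := ⟨e, h⟩

theorem trans (h : WeightEquiv w v) (h' : WeightEquiv v u) : WeightEquiv w u := by
  obtain ⟨e, he⟩ := h
  obtain ⟨f, hf⟩ := h'
  exact ⟨e.trans f, fun a ↦ by simp [he, hf]⟩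

theorem sigma {ι : Type*} {A B : ι → Type*} {w : (i : ι) → A i → ℕ} {v : (i : ι) → B i → ℕ}
    (h : ∀ i, WeightEquiv (w i) (v i)) :
    WeightEquiv (fun x : Σ i, A i ↦ w x.1 x.2) (fun x : Σ i, B i ↦ v x.1 x.2) := by
  choose e he using h
  exact ⟨Equiv.sigmaCongrRight e, fun x ↦ he x.1 x.2⟩

/-- The elements of a given weight correspond under a weight equivalence. -/
theorem nonempty_fiber_equiv (h : WeightEquiv w v) (n : ℕ) :
    Nonempty ({a // w a = n} ≃ {b // v b = n}) := by
  obtain ⟨e, he⟩ := h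
  exact ⟨e.subtypeEquiv fun a ↦ by rw [he]⟩

end WeightEquiv

/-! ### Interlacing sequences and the toggle of a diagonal -/

/-- The sequence `a, f 0, f 1, …`. -/
def prepend {α : Type*} (a : α) (f : ℕ → α) : ℕ → α
  | 0 => a
  | k + 1 => f k

@[simp] theorem prepend_zero {α : Type*} (a : α) (f : ℕ → α) : prepend a f 0 = a := rfl

@[simp] theorem prepend_succ {α : Type*} (a : α) (f : ℕ → α) (k : ℕ) :
    prepend a f (k + 1) = f k := rfl

/-- The sequence `μ` interlaces below `ν`: `ν 0 ≥ μ 0 ≥ ν 1 ≥ μ 1 ≥ ⋯`. -/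
def Interlaces (ν μ : ℕ →₀ ℕ) : Prop := ∀ k, ν (k + 1) ≤ μ k ∧ μ k ≤ ν k

theorem Finsupp.degree_eq_sum_range {f : ℕ →₀ ℕ} {K : ℕ} (h : ∀ k, K ≤ k → f k = 0) :
    f.degree = ∑ k ∈ Finset.range K, f k := by
  rw [Finsupp.degree_apply]
  refine Finset.sum_subset (fun k hk ↦ ?_) fun k _ hk ↦ by simpa using hk
  by_contra hk'
  exact (Finsupp.mem_support_iff.1 hk) (h k (by simpa using hk'))

theorem Finsupp.exists_forall_ge_eq_zero (f : ℕ →₀ ℕ) : ∃ K, ∀ k, K ≤ k → f k = 0 := by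
  refine ⟨f.support.sup id + 1, fun k hk ↦ ?_⟩
  by_contra h
  have := Finset.le_sup (f := id) (Finsupp.mem_support_iff.2 h)
  simp only [id] at this
  omega

theorem interlaces_zero : Interlaces 0 0 := fun k ↦ by simp

theorem Interlaces.eq_zero {μ : ℕ →₀ ℕ} (h : Interlaces 0 μ) : μ = 0 :=
  Finsupp.ext fun k ↦ by simpa using (h k).2

theorem Interlaces.degree_le {ν μ : ℕ →₀ ℕ} (h : Interlaces ν μ) : μ.degree ≤ ν.degree := by
  obtain ⟨K, hK⟩ := ν.exists_forall_ge_eq_zero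
  rw [Finsupp.degree_eq_sum_range hK, Finsupp.degree_eq_sum_range (K := K)]
  · exact Finset.sum_le_sum fun k _ ↦ (h k).2
  · intro k hk
    have := (h k).2
    have := hK k hk
    omega

/-- Toggling a diagonal: upper common interlacing neighbours of `a` and `b` correspond to
lower ones together with a natural number. -/
noncomputable def toggleEquiv (a b : ℕ →₀ ℕ) :
    {ν // Interlaces ν a ∧ Interlaces ν b} ≃ ℕ × {κ // Interlaces a κ ∧ Interlaces b κ} where
  -- Both `ν (k + 1)` and `κ k` range over the interval from `max (a (k + 1)) (b (k + 1))` to `min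
  -- (a k) (b k)`; the bijection reflects this interval. Only `ν 0` has no upper bound, and its
  -- excess over `max (a 0) (b 0)` is the natural number.
  toFun ν := ⟨ν.1 0 - max (a 0) (b 0),
    ⟨Finsupp.onFinset a.support
        (fun k ↦ min (a k) (b k) + max (a (k + 1)) (b (k + 1)) - ν.1 (k + 1)) (fun k hk ↦ by
          have h1 := ν.2.1 k
          have h2 := ν.2.2 k
          have h3 := ν.2.1 (k + 1)
          have h4 := ν.2.2 (k + 1)
          rw [Finsupp.mem_support_iff]
          omega),
      by
        constructor <;> intro k <;> rw [Finsupp.onFinset_apply] <;>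
        · have h1 := ν.2.1 k
          have h2 := ν.2.2 k
          have h3 := ν.2.1 (k + 1)
          have h4 := ν.2.2 (k + 1)
          omega⟩⟩
  invFun x :=
    ⟨Finsupp.onFinset (insert 0 (a.support.image Nat.succ))
        (prepend (max (a 0) (b 0) + x.1)
          fun k ↦ min (a k) (b k) + max (a (k + 1)) (b (k + 1)) - x.2.1 k) (fun k hk ↦ by
          cases k with
          | zero => simp
          | succ k =>
            have h1 := x.2.2.1 k
            have h2 := x.2.2.2 k
            simp only [Finset.mem_insert, Finset.mem_image, Finsupp.mem_support_iff]
            rw [prepend_succ] at hk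
            exact Or.inr ⟨k, by omega, rfl⟩),
      by
        constructor <;> intro k <;> rw [Finsupp.onFinset_apply, Finsupp.onFinset_apply] <;>
        · cases k with
          | zero =>
            have h1 := x.2.2.1 0
            have h2 := x.2.2.2 0
            simp only [prepend_zero, prepend_succ]
            omega
          | succ k =>
            have h1 := x.2.2.1 k
            have h2 := x.2.2.2 k
            have h3 := x.2.2.1 (k + 1)
            have h4 := x.2.2.2 (k + 1)
            simp only [prepend_succ]
            omega⟩
  left_inv ν := by
    ext k
    simp only [Finsupp.onFinset_apply]
    cases k with
    | zero =>
      have h1 := ν.2.1 0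
      have h2 := ν.2.2 0
      rw [prepend_zero]
      omega
    | succ k =>
      have h1 := ν.2.1 k
      have h2 := ν.2.2 k
      have h3 := ν.2.1 (k + 1)
      have h4 := ν.2.2 (k + 1)
      rw [prepend_succ]
      omega
  right_inv x := by
    refine Prod.ext ?_ (Subtype.ext (Finsupp.ext fun k ↦ ?_))
    · simp [Finsupp.onFinset_apply]
    · have h1 := x.2.2.1 k
      have h2 := x.2.2.2 k
      simp only [Finsupp.onFinset_apply, prepend_succ]
      omega

/-- Reflection makes `ν (k + 1) + κ k` the sum of the interval's endpoints. After summing over `k`,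
each min meets the max of the same index, and min + max = a + b. -/
theorem degree_add_degree_toggleEquiv (a b : ℕ →₀ ℕ)
    (ν : {ν // Interlaces ν a ∧ Interlaces ν b}) :
    ν.1.degree + (toggleEquiv a b ν).2.1.degree =
      a.degree + b.degree + (toggleEquiv a b ν).1 := by
  obtain ⟨K, hK⟩ := ν.1.exists_forall_ge_eq_zero
  have ha : ∀ k, K ≤ k → a k = 0 := fun k hk ↦ by
    have := (ν.2.1 k).2
    have := hK k hk
    omega
  have hb : ∀ k, K ≤ k → b k = 0 := fun k hk ↦ by
    have := (ν.2.2 k).2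
    have := hK k hk
    omega
  have hκ : ∀ k, K ≤ k → (toggleEquiv a b ν).2.1 k = 0 := fun k hk ↦ by
    have := ((toggleEquiv a b ν).2.2.1 k).2
    have := ha k hk
    omega
  have key : ∀ k, ν.1 (k + 1) + (toggleEquiv a b ν).2.1 k =
      min (a k) (b k) + max (a (k + 1)) (b (k + 1)) := fun k ↦ by
    have h1 := ν.2.1 k
    have h2 := ν.2.2 k
    have h3 := ν.2.1 (k + 1)
    have h4 := ν.2.2 (k + 1)
    simp only [toggleEquiv, Equiv.coe_fn_mk, Finsupp.onFinset_apply]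
    omega
  have key0 : ν.1 0 = max (a 0) (b 0) + (toggleEquiv a b ν).1 := by
    have h1 := ν.2.1 0
    have h2 := ν.2.2 0
    simp only [toggleEquiv, Equiv.coe_fn_mk]
    omega
  rw [Finsupp.degree_eq_sum_range (K := K + 1) fun k hk ↦ hK k (by omega),
    Finsupp.degree_eq_sum_range hκ, Finsupp.degree_eq_sum_range ha,
    Finsupp.degree_eq_sum_range hb, Finset.sum_range_succ', key0]
  have h1 := Finset.sum_congr rfl fun k (_ : k ∈ Finset.range K) ↦ key k
  have h2 : ∑ k ∈ Finset.range K, (a k + b k) =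
      ∑ k ∈ Finset.range K, (min (a k) (b k) + max (a k) (b k)) :=
    Finset.sum_congr rfl fun k _ ↦ by omega
  have h3 := Finset.sum_range_succ' (fun k ↦ max (a k) (b k)) K
  rw [Finset.sum_range_succ] at h3
  have h4 : max (a K) (b K) = 0 := by rw [ha K le_rfl, hb K le_rfl, max_self]
  simp only [Finset.sum_add_distrib] at h1 h2
  omega

/-! ### Chains of interlacing sequences and their commutation -/

/-- Sequences of successively interlacing sequences which start at `a` and vanish from
place `M` on. -/
def InterlacingChain (M : ℕ) (a : ℕ →₀ ℕ) : Type :=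
  {c : ℕ → ℕ →₀ ℕ // c 0 = a ∧ (∀ d, Interlaces (c d) (c (d + 1))) ∧ ∀ d, M ≤ d → c d = 0}

namespace InterlacingChain

/-- The total size of a chain. -/
noncomputable def size {M : ℕ} {a : ℕ →₀ ℕ} (c : InterlacingChain M a) : ℕ :=
  ∑ d ∈ Finset.range M, (c.1 d).degree

theorem interlaces_zero : Interlaces 0 0 := fun k ↦ by simp

theorem eq_zero {a : ℕ →₀ ℕ} (c : InterlacingChain 0 a) : a = 0 :=
  c.2.1.symm.trans (c.2.2.2 0 le_rfl)

theorem eq_zero_of_zero {M : ℕ} (c : InterlacingChain M 0) (d : ℕ) : c.1 d = 0 := by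
  induction d with
  | zero => exact c.2.1
  | succ d ih => 
    have := c.2.2.1 d
    rw [ih] at this
    exact this.eq_zero

instance (M : ℕ) : Unique (InterlacingChain M 0) where
  default := ⟨fun _ ↦ 0, rfl, fun _ ↦ interlaces_zero, fun _ _ ↦ rfl⟩
  uniq c := Subtype.ext (funext fun d ↦ c.eq_zero_of_zero d)

/-- Splitting off the first step of a chain. -/
def consEquiv (M : ℕ) (a : ℕ →₀ ℕ) :
    InterlacingChain (M + 1) a ≃ Σ b : {b // Interlaces a b}, InterlacingChain M b.1 where
  toFun c := ⟨⟨c.1 1, by simpa only [c.2.1] using c.2.2.1 0⟩,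
    ⟨fun d ↦ c.1 (d + 1), rfl, fun d ↦ c.2.2.1 (d + 1), fun d hd ↦ c.2.2.2 (d + 1) (by omega)⟩⟩
  invFun x := ⟨prepend a x.2.1, rfl,
    fun d ↦ by
      cases d with
      | zero => simpa only [prepend_zero, prepend_succ, x.2.2.1] using x.1.2
      | succ d => exact x.2.2.2.1 d,
    fun d hd ↦ by
      cases d with
      | zero => omega
      | succ d => exact x.2.2.2.2 d (by omega)⟩
  left_inv c := Subtype.ext <| funext fun d ↦ by
    cases d with
    | zero => exact c.2.1.symm
    | succ d => rfl
  right_inv := by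
    rintro ⟨⟨b, hb⟩, ⟨c, hc, h⟩⟩
    dsimp only at hc
    subst hc
    rfl

theorem size_eq_degree_add {M : ℕ} {a : ℕ →₀ ℕ} (c : InterlacingChain (M + 1) a) :
    c.size = a.degree + (consEquiv M a c).2.size := by
  rw [size, Finset.sum_range_succ', add_comm, c.2.1]
  rfl

theorem size_consEquiv_symm {M : ℕ} {a : ℕ →₀ ℕ}
    (x : Σ b : {b // Interlaces a b}, InterlacingChain M b.1) :
    ((consEquiv M a).symm x).size = a.degree + x.2.size := by
  obtain ⟨c, rfl⟩ := (consEquiv M a).surjective x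
  rw [Equiv.symm_apply_apply, size_eq_degree_add]

/-- The total size of a chain without its first sequence. -/
noncomputable def tailSize {M : ℕ} {a : ℕ →₀ ℕ} (c : InterlacingChain M a) : ℕ :=
  ∑ d ∈ Finset.range M, (c.1 (d + 1)).degree

theorem size_eq_degree_add_tailSize {M : ℕ} {a : ℕ →₀ ℕ} (c : InterlacingChain M a) :
    c.size = a.degree + c.tailSize := by
  have h1 := Finset.sum_range_succ (fun d ↦ (c.1 d).degree) M
  have h2 := Finset.sum_range_succ' (fun d ↦ (c.1 d).degree) M
  rw [c.2.2.2 M le_rfl, map_zero] at h1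
  rw [c.2.1] at h2
  rw [size, tailSize]
  omega

theorem tailSize_eq_size {M : ℕ} {a : ℕ →₀ ℕ} (c : InterlacingChain (M + 1) a) :
    c.tailSize = (consEquiv M a c).2.size := by
  have h1 := c.size_eq_degree_add
  have h2 := c.size_eq_degree_add_tailSize
  omega

/-- Reordering the choice of an upper neighbour `ν` of `a` and a lower neighbour `μ` of `ν`. -/
def sigmaUpperEquiv {M : ℕ} (a : ℕ →₀ ℕ) :
    (Σ ν : {ν // Interlaces ν a}, Σ μ : {μ // Interlaces ν.1 μ}, InterlacingChain M μ.1) ≃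
      Σ μ, {ν // Interlaces ν a ∧ Interlaces ν μ} × InterlacingChain M μ where
  toFun x := ⟨x.2.1.1, ⟨x.1.1, x.1.2, x.2.1.2⟩, x.2.2⟩
  invFun x := ⟨⟨x.2.1.1, x.2.1.2.1⟩, ⟨x.1, x.2.1.2.2⟩, x.2.2⟩
  left_inv _ := rfl
  right_inv _ := rfl

/-- Reordering the choice of a lower neighbour `κ` of `a` and an upper neighbour `μ` of `κ`. -/
def sigmaLowerEquiv {M : ℕ} (a : ℕ →₀ ℕ) :
    (Σ μ, (ℕ × {κ // Interlaces a κ ∧ Interlaces μ κ}) × InterlacingChain M μ) ≃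
      ℕ × Σ κ : {κ // Interlaces a κ}, Σ μ : {μ // Interlaces μ κ.1}, InterlacingChain M μ.1 where
  toFun x := ⟨x.2.1.1, ⟨x.2.1.2.1, x.2.1.2.2.1⟩, ⟨x.1, x.2.1.2.2.2⟩, x.2.2⟩
  invFun x := ⟨x.2.2.1.1, ⟨x.1, x.2.1.1, x.2.1.2, x.2.2.1.2⟩, x.2.2.2⟩
  left_inv _ := rfl
  right_inv _ := rfl

/-- Commuting an upward step past a chain produces one natural number for every step. -/
theorem weightEquiv_sigma_interlaces (M y : ℕ) (a : ℕ →₀ ℕ) :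
    WeightEquiv
      (fun x : Σ ν : {ν // Interlaces ν a}, InterlacingChain M ν.1 ↦
        y * (x.1.1.degree - a.degree) + x.2.size)
      (fun x : (Fin M → ℕ) × InterlacingChain M a ↦ ∑ j, x.1 j * (y + j + 1) + x.2.size) := by
  induction M generalizing y a with
  | zero =>
    -- A chain vanishing from place 0 on starts at 0, so both sides have one element if `a = 0` and
    -- none otherwise.
    refine .of_equiv ⟨fun x ↦ ⟨Fin.elim0, ⟨fun _ ↦ 0, ?_, fun _ ↦ interlaces_zero,
      fun _ _ ↦ rfl⟩⟩, fun x ↦ ⟨⟨0, ?_⟩, default⟩, ?_, ?_⟩ ?_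
    · have h := x.1.2
      rw [x.2.eq_zero] at h
      exact (h.eq_zero).symm
    · rw [x.2.eq_zero]
      exact interlaces_zero
    · rintro ⟨⟨ν, hν⟩, c⟩
      obtain rfl : ν = 0 := c.eq_zero
      exact Sigma.ext rfl (heq_of_eq (Subsingleton.elim _ _))
    · rintro ⟨m, c⟩
      obtain rfl : a = 0 := c.eq_zero
      exact Prod.ext (Subsingleton.elim _ _) (Subsingleton.elim _ _)
    · rintro ⟨⟨ν, hν⟩, c⟩
      obtain rfl : ν = 0 := c.eq_zero
      simp [size]
  | succ M ih =>
    -- Let μ be the second term of the chain starting at ν. Toggling ν against a and μ replaces the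
    -- corner a, ν, μ by a, κ, μ and releases a number of weight y + 1: one more than y, because ν
    -- is also counted in the size. The upward step from κ to μ remains, now with weight y + 1 per
    -- unit, as the induction hypothesis requires.
    refine .trans (v := fun x : ℕ × Σ κ : {κ // Interlaces a κ},
        Σ μ : {μ // Interlaces μ κ.1}, InterlacingChain M μ.1 ↦
      (y + 1) * x.1 + a.degree + ((y + 1) * (x.2.2.1.1.degree - x.2.1.1.degree) + x.2.2.2.size))
      (.of_equiv (((Equiv.sigmaCongrRight fun ν : {ν // Interlaces ν a} ↦ consEquiv M ν.1).trans
        (sigmaUpperEquiv a)).trans ((Equiv.sigmaCongrRight fun μ ↦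
          (toggleEquiv a μ).prodCongr (.refl _)).trans (sigmaLowerEquiv a))) ?_)
      (.trans (v := fun x : ℕ × Σ κ : {κ // Interlaces a κ},
        (Fin M → ℕ) × InterlacingChain M κ.1 ↦
        (y + 1) * x.1 + a.degree + (∑ j, x.2.2.1 j * (y + 1 + j + 1) + x.2.2.2.size))
        ?_ (.of_equiv ⟨fun x ↦ ⟨Fin.cons x.1 x.2.2.1, (consEquiv M a).symm ⟨x.2.1, x.2.2.2⟩⟩,
          fun x ↦ ⟨x.1 0, (consEquiv M a x.2).1, Fin.tail x.1, (consEquiv M a x.2).2⟩, ?_, ?_⟩ ?_))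
    · rintro ⟨⟨ν, hν⟩, c⟩
      rw [size_eq_degree_add]
      change (y + 1) * (toggleEquiv a _ ⟨ν, hν, (consEquiv M ν c).1.2⟩).1 + a.degree +
        ((y + 1) * ((consEquiv M ν c).1.1.degree -
          (toggleEquiv a _ ⟨ν, hν, (consEquiv M ν c).1.2⟩).2.1.degree) +
          (consEquiv M ν c).2.size) = y * (ν.degree - a.degree) +
            (ν.degree + (consEquiv M ν c).2.size)
      obtain ⟨⟨μ, hμ⟩, c⟩ := consEquiv M ν c
      have h := degree_add_degree_toggleEquiv a μ ⟨ν, hν, hμ⟩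
      have h1 := hν.degree_le
      have h2 := (toggleEquiv a μ ⟨ν, hν, hμ⟩).2.2.2.degree_le
      dsimp only
      generalize toggleEquiv a μ ⟨ν, hν, hμ⟩ = t at *
      obtain ⟨p, hp⟩ := Nat.exists_eq_add_of_le h1
      obtain ⟨q, hq⟩ := Nat.exists_eq_add_of_le h2
      rw [hp, hq, Nat.add_sub_cancel_left, Nat.add_sub_cancel_left]
      -- Here p = |ν| - |a| and q = |μ| - |κ|, so this is the degree identity of the toggle.
      obtain rfl : p = q + t.1 := by dsimp only at h; omega
      ring
    · obtain ⟨e, he⟩ := WeightEquiv.sigma fun κ : {κ // Interlaces a κ} ↦ ih (y + 1) κ.1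
      refine ⟨(Equiv.refl ℕ).prodCongr e, fun x ↦ ?_⟩
      exact congrArg _ (he x.2)
    · rintro ⟨n, κ, m, c⟩
      have h := (consEquiv M a).apply_symm_apply ⟨κ, c⟩
      dsimp only
      generalize consEquiv M a _ = z at h
      subst h
      rfl
    · rintro ⟨m, c⟩
      simp only [Fin.cons_self_tail, Sigma.eta, Equiv.symm_apply_apply]
    · rintro ⟨n, κ, m, c⟩
      simp only [Equiv.coe_fn_mk, size_consEquiv_symm, Fin.sum_univ_succ,
        Fin.cons_zero, Fin.cons_succ, Fin.val_zero, Fin.val_succ]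
      rw [Finset.sum_congr rfl fun j _ ↦
        show m j * (y + (j + 1) + 1) = m j * (y + 1 + j + 1) by ring]
      ring

/-- The pairs of chains from a common start correspond to matrices of natural numbers. -/
theorem weightEquiv_matrix (N M y : ℕ) :
    WeightEquiv
      (fun x : Σ a, InterlacingChain N a × InterlacingChain M a ↦
        y * x.1.degree + x.2.1.tailSize + x.2.2.size)
      (fun m : Fin N → Fin M → ℕ ↦ ∑ i, ∑ j, m i j * (y + i + j + 1)) := by
  induction N generalizing y with
  | zero =>
    refine .of_equiv ⟨fun _ ↦ Fin.elim0, fun _ ↦ ⟨0, default, default⟩, ?_,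
      fun _ ↦ Subsingleton.elim _ _⟩ ?_
    · rintro ⟨a, c, c'⟩
      obtain rfl : a = 0 := c.eq_zero
      exact Sigma.ext rfl (heq_of_eq (Subsingleton.elim _ _))
    · rintro ⟨a, c, c'⟩
      obtain rfl : a = 0 := c.eq_zero
      simp [tailSize, size, c'.eq_zero_of_zero]
  | succ N ih =>
    -- The first step of the lower chain, from a down to b, is an upward step from b to a preceding
    -- the upper chain. Commuting it past that chain yields the first row of the matrix. What
    -- remains starts at b with coefficient y + 1, since |b| is counted y times and once more in the
    -- old tail.
    refine .trans (v := fun x : Σ b, InterlacingChain N b ×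
        Σ a : {a // Interlaces a b}, InterlacingChain M a.1 ↦
      y * (x.2.2.1.1.degree - x.1.degree) + x.2.2.2.size +
        ((y + 1) * x.1.degree + x.2.1.tailSize)) (.of_equiv (.trans (Equiv.sigmaCongrRight fun a ↦
          (consEquiv N a).prodCongr (.refl _)) ⟨fun x ↦ ⟨x.2.1.1.1, x.2.1.2, ⟨x.1, x.2.1.1.2⟩, x.2.2⟩,
            fun x ↦ ⟨x.2.2.1.1, ⟨⟨x.1, x.2.2.1.2⟩, x.2.1⟩, x.2.2.2⟩, fun _ ↦ rfl, fun _ ↦ rfl⟩) ?_)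
      (.trans (v := fun x : Σ b, InterlacingChain N b × (Fin M → ℕ) × InterlacingChain M b ↦
        ∑ j, x.2.2.1 j * (y + j + 1) + x.2.2.2.size + ((y + 1) * x.1.degree + x.2.1.tailSize))
        ?_ (.trans (v := fun x : (Fin M → ℕ) ×
          Σ b, InterlacingChain N b × InterlacingChain M b ↦ ∑ j, x.1 j * (y + j + 1) +
            ((y + 1) * x.2.1.degree + x.2.2.1.tailSize + x.2.2.2.size))
          (.of_equiv ⟨fun x ↦ ⟨x.2.2.1, x.1, x.2.1, x.2.2.2⟩, fun x ↦ ⟨x.2.1, x.2.2.1, x.1, x.2.2.2⟩,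
            fun _ ↦ rfl, fun _ ↦ rfl⟩ fun x ↦ ?_) ?_))
    · rintro ⟨a, c, c'⟩
      rw [tailSize_eq_size]
      change y * (a.degree - (consEquiv N a c).1.1.degree) + c'.size +
        ((y + 1) * (consEquiv N a c).1.1.degree + (consEquiv N a c).2.tailSize) =
          y * a.degree + (consEquiv N a c).2.size + c'.size
      obtain ⟨p, hp⟩ := Nat.exists_eq_add_of_le (consEquiv N a c).1.2.degree_le
      rw [hp, Nat.add_sub_cancel_left, size_eq_degree_add_tailSize (consEquiv N a c).2]
      ring
    · refine .sigma (w := fun b (x : InterlacingChain N b ×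
          Σ a : {a // Interlaces a b}, InterlacingChain M a.1) ↦
        y * (x.2.1.1.degree - b.degree) + x.2.2.size + ((y + 1) * b.degree + x.1.tailSize))
        (v := fun b (x : InterlacingChain N b × (Fin M → ℕ) × InterlacingChain M b) ↦
          ∑ j, x.2.1 j * (y + j + 1) + x.2.2.size + ((y + 1) * b.degree + x.1.tailSize))
        fun b ↦ ?_
      obtain ⟨e, he⟩ := weightEquiv_sigma_interlaces M y b
      exact ⟨(Equiv.refl _).prodCongr e, fun x ↦
        congrArg (· + ((y + 1) * b.degree + x.1.tailSize)) (he x.2)⟩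
    · dsimp only [Equiv.coe_fn_mk]
      ring
    · obtain ⟨e, he⟩ := ih (y + 1)
      refine ⟨((Equiv.refl _).prodCongr e).trans (Fin.consEquiv fun _ ↦ Fin M → ℕ), fun x ↦ ?_⟩
      have h := he x.2
      dsimp only at h ⊢
      rw [← h]
      simp [Fin.sum_univ_succ, Fin.consEquiv, add_assoc, add_comm, add_left_comm]

end InterlacingChain

/-! ### Square arrays and their diagonals -/

/-- Summing over a square by diagonals. -/
theorem sum_range_product_eq_sum_diagonals {N : ℕ} {f : ℕ × ℕ → ℕ}
    (hf : ∀ i j, N ≤ i ∨ N ≤ j → f (i, j) = 0) :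
    ∑ p ∈ Finset.range N ×ˢ Finset.range N, f p =
      ∑ d ∈ Finset.range N, ∑ k ∈ Finset.range N, f (k + (d + 1), k) +
        ∑ d ∈ Finset.range N, ∑ k ∈ Finset.range N, f (k, k + d) := by
  rw [← Finset.sum_filter_add_sum_filter_not _ (fun p : ℕ × ℕ ↦ p.2 < p.1),
    ← Finset.sum_product', ← Finset.sum_product']
  congr 1
  -- Pairs (d, k) whose cell leaves the square contribute 0, so they can be dropped before
  -- reindexing. The offset d + 1 keeps the main diagonal out of this half.
  · rw [← Finset.sum_filter_of_ne (s := Finset.range N ×ˢ Finset.range N)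
      (p := fun p ↦ p.2 + (p.1 + 1) < N)]
    · refine Finset.sum_nbij' (fun p ↦ (p.1 - p.2 - 1, p.2)) (fun p ↦ (p.2 + (p.1 + 1), p.2))
        ?_ ?_ ?_ ?_ ?_ <;> rintro ⟨i, j⟩ h <;>
        simp only [Finset.mem_filter, Finset.mem_product, Finset.mem_range, Prod.mk.injEq,
          and_true] at h ⊢
      any_goals omega
      rw [show j + (i - j - 1 + 1) = i by omega]
    · rintro ⟨d, k⟩ - h
      by_contra h'
      exact h (hf _ _ (Or.inl (not_lt.1 h')))
  · rw [← Finset.sum_filter_of_ne (s := Finset.range N ×ˢ Finset.range N)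
      (p := fun p ↦ p.2 + p.1 < N)]
    · refine Finset.sum_nbij' (fun p ↦ (p.2 - p.1, p.1)) (fun p ↦ (p.2, p.2 + p.1))
        ?_ ?_ ?_ ?_ ?_ <;> rintro ⟨i, j⟩ h <;>
        simp only [Finset.mem_filter, Finset.mem_product, Finset.mem_range, Prod.mk.injEq,
          and_true, true_and] at h ⊢
      any_goals omega
      rw [show i + (j - i) = j by omega]
    · rintro ⟨d, k⟩ - h
      by_contra h'
      exact h (hf _ _ (Or.inr (not_lt.1 h')))

namespace InterlacingChain

/-- Interlacing bounds place k + 1 at step d by place k at step d + 1, so moving along antidiagonals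
reaches a step where the chain has vanished. -/
theorem apply_eq_zero {N : ℕ} {a : ℕ →₀ ℕ} (c : InterlacingChain N a) {d k : ℕ}
    (h : N ≤ k + d) : c.1 d k = 0 := by
  induction k generalizing d with
  | zero => rw [c.2.2.2 d (by omega)]; rfl
  | succ k ih => exact Nat.le_zero.1 (((c.2.2.1 d k).1).trans (ih (by omega)).le)

/-- The square array with given diagonals. -/
def glue {N M : ℕ} {a : ℕ →₀ ℕ} (c : InterlacingChain N a) (c' : InterlacingChain M a)
    (p : ℕ × ℕ) : ℕ :=
  if p.2 ≤ p.1 then c.1 (p.1 - p.2) p.2 else c'.1 (p.2 - p.1) p.1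

variable {N M : ℕ} {a : ℕ →₀ ℕ} (c : InterlacingChain N a) (c' : InterlacingChain M a)

theorem glue_left (k d : ℕ) : glue c c' (k + d, k) = c.1 d k := by
  simp [glue]

theorem glue_right (k d : ℕ) : glue c c' (k, k + d) = c'.1 d k := by
  cases d with
  | zero => simp [glue, c.2.1, c'.2.1]
  | succ d => simp [glue]

/-- The two inequalities of interlacing are the two directions of monotonicity; they exchange roles
across the main diagonal. -/
theorem glue_succ_left_le (i j : ℕ) : glue c c' (i + 1, j) ≤ glue c c' (i, j) := by
  obtain h | h := le_or_gt j i
  · obtain ⟨d, rfl⟩ := Nat.exists_eq_add_of_le h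
    rw [add_assoc, glue_left, glue_left]
    exact (c.2.2.1 d j).2
  · obtain ⟨d, rfl⟩ := Nat.exists_eq_add_of_le h
    rw [glue_right, show i.succ + d = i + (d + 1) by omega, glue_right]
    exact (c'.2.2.1 d i).1

theorem glue_succ_right_le (i j : ℕ) : glue c c' (i, j + 1) ≤ glue c c' (i, j) := by
  obtain h | h := le_or_gt i j
  · obtain ⟨d, rfl⟩ := Nat.exists_eq_add_of_le h
    rw [add_assoc, glue_right, glue_right]
    exact (c'.2.2.1 d i).2
  · obtain ⟨d, rfl⟩ := Nat.exists_eq_add_of_le h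
    rw [glue_left, show j.succ + d = j + (d + 1) by omega, glue_left]
    exact (c.2.2.1 d j).1

end InterlacingChain

/-! ### Plane partitions in a square as pairs of chains -/

namespace PlanePartition

/-- The plane partitions supported in a square of side `N`. -/
abbrev InSquare (N : ℕ) : Type :=
  {π : PlanePartition // ∀ i j, N ≤ i ∨ N ≤ j → π.entry (i, j) = 0}

/-- The chain of diagonals below the main diagonal. -/
noncomputable def lowerChain {N : ℕ} (π : InSquare N) :
    InterlacingChain N
      (π.1.entry.comapDomain (fun k ↦ (k, k)) fun _ _ _ _ h ↦ (Prod.ext_iff.1 h).1) :=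
  ⟨fun d ↦ π.1.entry.comapDomain (fun k ↦ (k + d, k)) fun _ _ _ _ h ↦ (Prod.ext_iff.1 h).2,
    rfl, fun d k ↦ ⟨
      (congrArg (fun x ↦ π.1.entry (x, k + 1)) (by omega : k + 1 + d = k + (d + 1))).trans_le
        (π.1.entry_succ_right_le (k + (d + 1)) k),
      π.1.entry_succ_left_le _ _⟩,
    fun d hd ↦ Finsupp.ext fun k ↦ π.2 _ _ (Or.inl (by omega))⟩

/-- The chain of diagonals above the main diagonal. -/
noncomputable def upperChain {N : ℕ} (π : InSquare N) :
    InterlacingChain N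
      (π.1.entry.comapDomain (fun k ↦ (k, k)) fun _ _ _ _ h ↦ (Prod.ext_iff.1 h).1) :=
  ⟨fun d ↦ π.1.entry.comapDomain (fun k ↦ (k, k + d)) fun _ _ _ _ h ↦ (Prod.ext_iff.1 h).1,
    rfl, fun d k ↦ ⟨
      (congrArg (fun x ↦ π.1.entry (k + 1, x)) (by omega : k + 1 + d = k + (d + 1))).trans_le
        (π.1.entry_succ_left_le k (k + (d + 1))),
      π.1.entry_succ_right_le _ _⟩,
    fun d hd ↦ Finsupp.ext fun k ↦ π.2 _ _ (Or.inr (by omega))⟩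

/-- A plane partition in a square is determined by its two chains of diagonals. -/
noncomputable def diagonalEquiv (N : ℕ) :
    InSquare N ≃ Σ a, InterlacingChain N a × InterlacingChain N a where
  toFun π := ⟨_, lowerChain π, upperChain π⟩
  invFun x := ⟨⟨Finsupp.onFinset (Finset.range N ×ˢ Finset.range N) (x.2.1.glue x.2.2) (by
      rintro ⟨i, j⟩ h
      contrapose! h
      simp only [Finset.mem_product, Finset.mem_range] at h
      obtain hij | hij := le_total j i
      · obtain ⟨d, rfl⟩ := Nat.exists_eq_add_of_le hij
        rw [x.2.1.glue_left, x.2.1.apply_eq_zero (by omega)]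
      · obtain ⟨d, rfl⟩ := Nat.exists_eq_add_of_le hij
        rw [x.2.1.glue_right, x.2.2.apply_eq_zero (by omega)]),
      x.2.1.glue_succ_left_le x.2.2, x.2.1.glue_succ_right_le x.2.2⟩, by
      intro i j h
      rw [Finsupp.onFinset_apply]
      obtain hij | hij := le_total j i
      · obtain ⟨d, rfl⟩ := Nat.exists_eq_add_of_le hij
        rw [x.2.1.glue_left, x.2.1.apply_eq_zero (by omega)]
      · obtain ⟨d, rfl⟩ := Nat.exists_eq_add_of_le hij
        rw [x.2.1.glue_right, x.2.2.apply_eq_zero (by omega)]⟩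
  left_inv π := by
    refine Subtype.ext (PlanePartition.ext (Finsupp.ext fun ⟨i, j⟩ ↦ ?_))
    rw [Finsupp.onFinset_apply]
    obtain hij | hij := le_total j i
    · obtain ⟨d, rfl⟩ := Nat.exists_eq_add_of_le hij
      rw [InterlacingChain.glue_left]
      rfl
    · obtain ⟨d, rfl⟩ := Nat.exists_eq_add_of_le hij
      rw [InterlacingChain.glue_right]
      rfl
  right_inv x := by
    -- The starting sequence is recovered as term 0 of a chain, so termwise agreement suffices and
    -- no equality across dependent types is needed.
    have main {b : ℕ →₀ ℕ} {y : InterlacingChain N b × InterlacingChain N b}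
        (h : ∀ d, y.1.1 d = x.2.1.1 d) (h' : ∀ d, y.2.1 d = x.2.2.1 d) :
        (⟨b, y⟩ : Σ a, InterlacingChain N a × InterlacingChain N a) = x := by
      obtain ⟨a, c, c'⟩ := x
      obtain ⟨e, e'⟩ := y
      obtain rfl : b = a := by rw [← e.2.1, ← c.2.1]; exact h 0
      obtain rfl : e = c := Subtype.ext (funext h)
      obtain rfl : e' = c' := Subtype.ext (funext h')
      rfl
    exact main (fun d ↦ Finsupp.ext fun k ↦ x.2.1.glue_left x.2.2 k d)
      fun d ↦ Finsupp.ext fun k ↦ x.2.1.glue_right x.2.2 k d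

theorem boxes_eq_sum_square {N : ℕ} (π : InSquare N) :
    π.1.boxes = ∑ p ∈ Finset.range N ×ˢ Finset.range N, π.1.entry p := by
  refine Finset.sum_subset (fun p hp ↦ ?_) fun p _ hp ↦ by simpa using hp
  by_contra h
  simp only [Finset.mem_product, Finset.mem_range] at h
  exact (Finsupp.mem_support_iff.1 hp) (π.2 p.1 p.2 (by omega))

theorem boxes_eq_tailSize_add_size {N : ℕ} (π : InSquare N) :
    π.1.boxes = (lowerChain π).tailSize + (upperChain π).size := by
  rw [boxes_eq_sum_square, sum_range_product_eq_sum_diagonals π.2]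
  congr 1 <;> refine Finset.sum_congr rfl fun d _ ↦ ?_
  · rw [Finsupp.degree_eq_sum_range (K := N) fun k hk ↦ (lowerChain π).apply_eq_zero (by omega)]
    rfl
  · rw [Finsupp.degree_eq_sum_range (K := N) fun k hk ↦ (upperChain π).apply_eq_zero (by omega)]
    rfl

theorem weightEquiv_matrix (N : ℕ) :
    WeightEquiv (fun π : InSquare N ↦ π.1.boxes)
      (fun m : Fin N × Fin N → ℕ ↦ ∑ p, m p * (p.1 + p.2 + 1)) := by
  refine .trans (.of_equiv (diagonalEquiv N) fun π ↦ ?_)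
    ((InterlacingChain.weightEquiv_matrix N N 0).trans
      (.of_equiv (Equiv.curry _ _ _).symm fun m ↦ ?_))
  · rw [boxes_eq_tailSize_add_size, zero_mul, zero_add]
    rfl
  · rw [Fintype.sum_prod_type]
    simp

theorem entry_antitone (π : PlanePartition) {i i' j j' : ℕ} (hi : i ≤ i') (hj : j ≤ j') :
    π.entry (i', j') ≤ π.entry (i, j) :=
  (antitone_nat_of_succ_le (f := fun i ↦ π.entry (i, j')) (fun i ↦ π.entry_succ_left_le i j') hi).trans
    (antitone_nat_of_succ_le (f := fun j ↦ π.entry (i, j)) (fun j ↦ π.entry_succ_right_le i j) hj)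

/-- By monotonicity a nonzero entry at (i, j) forces i + 1 nonzero entries in column 0 and j + 1 in
row 0. Thus n boxes always fit in a square of side n. -/
theorem lt_boxes (π : PlanePartition) {i j : ℕ} (h : π.entry (i, j) ≠ 0) :
    i < π.boxes ∧ j < π.boxes := by
  have key (f : ℕ → ℕ × ℕ) (hf : f.Injective) (n : ℕ) (hn : ∀ k ≤ n, π.entry (f k) ≠ 0) :
      n < π.boxes := by
    have hs : (Finset.range (n + 1)).image f ⊆ π.entry.support := by
      intro p hp
      obtain ⟨k, hk, rfl⟩ := Finset.mem_image.1 hp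
      exact Finsupp.mem_support_iff.2 (hn k (by simpa [Nat.lt_succ_iff] using hk))
    calc n < ((Finset.range (n + 1)).image f).card := by
          rw [Finset.card_image_of_injective _ hf, Finset.card_range]; omega
      _ ≤ π.entry.support.card := Finset.card_le_card hs
      _ = ∑ _p ∈ π.entry.support, 1 := by simp
      _ ≤ π.boxes := Finset.sum_le_sum fun p hp ↦
          Nat.one_le_iff_ne_zero.2 (Finsupp.mem_support_iff.1 hp)
  constructor
  · refine key (fun k ↦ (k, 0)) (fun _ _ h ↦ (Prod.ext_iff.1 h).1) i fun k hk ↦ ?_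
    have := π.entry_antitone hk (Nat.zero_le j)
    omega
  · refine key (fun k ↦ (0, k)) (fun _ _ h ↦ (Prod.ext_iff.1 h).2) j fun k hk ↦ ?_
    have := π.entry_antitone (Nat.zero_le i) hk
    omega

/-- Plane partitions with `n` boxes correspond to matrices of weight `n`. -/
theorem nonempty_equiv_matrix {n N : ℕ} (h : n ≤ N) :
    Nonempty ({π : PlanePartition // π.boxes = n} ≃
      {m : Fin N × Fin N → ℕ // ∑ p, m p * (p.1 + p.2 + 1) = n}) := by
  obtain ⟨e⟩ := (weightEquiv_matrix N).nonempty_fiber_equiv n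
  let f : {π : PlanePartition // π.boxes = n} ≃ {π : InSquare N // π.1.boxes = n} :=
    { toFun π := ⟨⟨π.1, fun i j hij ↦ by
        by_contra h'
        have := π.1.lt_boxes h'
        have := π.2
        omega⟩, π.2⟩
      invFun π := ⟨π.1.1, π.2⟩
      left_inv _ := rfl
      right_inv _ := rfl }
  exact ⟨f.trans e⟩

end PlanePartition

/-! ### Products of geometric series -/

namespace PowerSeries

variable {K : Type*} [Field K]

theorem inv_one_sub_X_pow {w : ℕ} (hw : 0 < w) :
    (1 - (X : K⟦X⟧) ^ w)⁻¹ = mk fun n ↦ if w ∣ n then 1 else 0 := by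
  rw [inv_eq_iff_mul_eq_one (by simp [hw.ne'])]
  ext n
  rw [mul_sub, mul_one, map_sub, coeff_mul_X_pow', coeff_mk, coeff_one]
  obtain h | h := le_or_gt w n
  · obtain ⟨k, rfl⟩ := Nat.exists_eq_add_of_le h
    simp [hw.ne']
  · have h1 : w ∣ n ↔ n = 0 := ⟨fun hn ↦ Nat.eq_zero_of_dvd_of_lt hn h, fun hn ↦ hn ▸ dvd_zero w⟩
    simp [h1, h.not_ge]

theorem inv_pow_eq_pow_inv {f : K⟦X⟧} (hf : constantCoeff f ≠ 0) (k : ℕ) :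
    (f ^ k)⁻¹ = f⁻¹ ^ k := by
  rw [inv_eq_iff_mul_eq_one (by simpa using fun h ↦ absurd h hf), ← mul_pow,
    PowerSeries.inv_mul_cancel f hf, one_pow]

/-- The coefficients of a product of geometric series count the functions of a given weight. -/
theorem coeff_prod_inv_one_sub_X_pow {ι : Type*} [Fintype ι] [DecidableEq ι] {w : ι → ℕ}
    (hw : ∀ i, 0 < w i) (n : ℕ) :
    Finite {m : ι → ℕ // ∑ i, m i * w i = n} ∧
    coeff n (∏ i, (1 - (X : K⟦X⟧) ^ w i)⁻¹) =
      (Nat.card {m : ι → ℕ // ∑ i, m i * w i = n} : K) := by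
  -- Recording the multiples `m i * w i` instead of `m i` turns the functions into the exponent
  -- tuples with sum n that survive in the product of geometric series.
  let e : {m : ι → ℕ // ∑ i, m i * w i = n} ≃
      {l : ι →₀ ℕ // l ∈ (Finset.finsuppAntidiag Finset.univ n).filter fun l ↦ ∀ i, w i ∣ l i} :=
    { toFun m := ⟨Finsupp.equivFunOnFinite.symm fun i ↦ m.1 i * w i, by
        simp [m.2]⟩
      invFun l := ⟨fun i ↦ l.1 i / w i, by
        have h := l.2
        simp only [Finset.mem_filter, Finset.mem_finsuppAntidiag] at h
        refine .trans ?_ h.1.1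
        exact Finset.sum_congr rfl fun i _ ↦ Nat.div_mul_cancel (h.2 i)⟩
      left_inv m := Subtype.ext <| funext fun i ↦ Nat.mul_div_cancel _ (hw i)
      right_inv l := Subtype.ext <| Finsupp.ext fun i ↦
        Nat.div_mul_cancel ((Finset.mem_filter.1 l.2).2 i) }
  refine ⟨.of_equiv _ e.symm, ?_⟩
  rw [Nat.card_congr e, Nat.card_eq_fintype_card, Fintype.card_coe, coeff_prod,
    Finset.card_filter]
  push_cast
  refine Finset.sum_congr rfl fun l _ ↦ ?_
  simp only [inv_one_sub_X_pow (hw _), coeff_mk]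
  rw [Finset.prod_ite_zero]
  simp

/-- Used to discard the factors outside a large square when reading a low coefficient. -/
theorem X_pow_dvd_prod_sub_one {ι : Type*} {n : ℕ} {g : ι → K⟦X⟧} {s : Finset ι}
    (h : ∀ i ∈ s, X ^ n ∣ g i - 1) : X ^ n ∣ ∏ i ∈ s, g i - 1 := by
  induction s using Finset.cons_induction with
  | empty => simp
  | cons i s hi ih =>
    rw [Finset.prod_cons, show g i * ∏ j ∈ s, g j - 1 =
      (g i - 1) * ∏ j ∈ s, g j + (∏ j ∈ s, g j - 1) by ring]
    exact dvd_add (dvd_mul_of_dvd_left (h i (Finset.mem_cons_self i s)) _)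
      (ih fun j hj ↦ h j (Finset.mem_cons_of_mem hj))

theorem X_pow_dvd_inv_one_sub_X_pow_sub_one {n w : ℕ} (hw : 0 < w) (h : n ≤ w) :
    X ^ n ∣ (1 - (X : K⟦X⟧) ^ w)⁻¹ - 1 := by
  have h1 : (1 - (X : K⟦X⟧) ^ w)⁻¹ - 1 = X ^ w * (1 - (X : K⟦X⟧) ^ w)⁻¹ := by
    have := PowerSeries.mul_inv_cancel (1 - (X : K⟦X⟧) ^ w) (by simp [hw.ne'])
    linear_combination this
  rw [h1]
  exact dvd_mul_of_dvd_left (pow_dvd_pow _ h) _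

end PowerSeries

open PowerSeries

/-! ### Passage to the infinite product and the first values -/

namespace PlanePartition

theorem finite_setOf_boxes_eq (n : ℕ) : {π : PlanePartition | π.boxes = n}.Finite := by
  obtain ⟨e⟩ := nonempty_equiv_matrix (le_refl n)
  have := (coeff_prod_inv_one_sub_X_pow (K := ℚ) (w := fun p : Fin n × Fin n ↦ p.1 + p.2 + 1)
    (fun _ ↦ Nat.succ_pos _) n).1
  exact Set.finite_coe_iff.1 (Finite.of_equiv _ e.symm)

theorem coeff_prod_square (K : Type*) [Field K] {n N : ℕ} (h : n ≤ N) :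
    coeff n (∏ p ∈ Finset.range N ×ˢ Finset.range N, (1 - (X : K⟦X⟧) ^ (p.1 + p.2 + 1))⁻¹) =
      (planePartitionCount n : K) := by
  obtain ⟨e⟩ := nonempty_equiv_matrix h
  rw [planePartitionCount, Nat.card_congr e, ← (coeff_prod_inv_one_sub_X_pow
    (w := fun p : Fin N × Fin N ↦ p.1 + p.2 + 1) (fun _ ↦ Nat.succ_pos _) n).2,
    Fintype.prod_prod_type, Finset.prod_product, Finset.prod_range]
  simp only [Finset.prod_range]

variable (K : Type*) [Field K] [TopologicalSpace K]

/-- Coefficient n is the same for every finite set of cells containing the n-square: a cell outside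
has i + j + 1 ≥ n + 1, so its factor is 1 modulo X^(n+1). Being eventually constant, it converges
for any topology on `K`. -/
theorem hasProd_inv_one_sub_X_pow :
    HasProd (fun p : ℕ × ℕ ↦ (1 - (X : K⟦X⟧) ^ (p.1 + p.2 + 1))⁻¹) (planePartitionSeries K) := by
  rw [HasProd, SummationFilter.unconditional_filter, WithPiTopology.tendsto_iff_coeff_tendsto]
  intro n
  refine tendsto_const_nhds.congr' ?_
  filter_upwards [Filter.eventually_ge_atTop (Finset.range n ×ˢ Finset.range n)] with s hs
  rw [planePartitionSeries, coeff_mk, ← coeff_prod_square K (le_refl n), ← Finset.prod_sdiff hs]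
  have h : X ^ (n + 1) ∣ ∏ p ∈ s \ (Finset.range n ×ˢ Finset.range n),
      (1 - (X : K⟦X⟧) ^ (p.1 + p.2 + 1))⁻¹ - 1 := by
    refine X_pow_dvd_prod_sub_one fun p hp ↦
      X_pow_dvd_inv_one_sub_X_pow_sub_one (Nat.succ_pos _) ?_
    simp only [Finset.mem_sdiff, Finset.mem_product, Finset.mem_range] at hp
    omega
  rw [eq_comm, ← sub_eq_zero, ← map_sub, ← sub_one_mul]
  exact X_pow_dvd_iff.1 (dvd_mul_of_dvd_left h _) n (Nat.lt_succ_self n)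

/-- The antidiagonal i + j = n has n + 1 cells with equal factors. Discreteness of `K` supplies the
continuity of multiplication and the regularity needed to regroup the product. -/
theorem hasProd_planePartitionSeries [DiscreteTopology K] :
    HasProd (fun n : ℕ ↦ ((1 - (X : K⟦X⟧) ^ (n + 1)) ^ (n + 1))⁻¹) (planePartitionSeries K) := by
  have h := (Finset.HasAntidiagonal.sigmaAntidiagonalEquivProd.hasProd_iff).2
    (hasProd_inv_one_sub_X_pow K)
  refine HasProd.sigma h fun n ↦ ?_
  have hn : ((1 - (X : K⟦X⟧) ^ (n + 1)) ^ (n + 1))⁻¹ =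
      ∏ p : Finset.HasAntidiagonal.antidiagonal n, (1 - (X : K⟦X⟧) ^ (p.1.1 + p.1.2 + 1))⁻¹ := by
    rw [Finset.prod_congr rfl (g := fun _ ↦ (1 - (X : K⟦X⟧) ^ (n + 1))⁻¹) fun p _ ↦ by
      rw [Finset.HasAntidiagonal.mem_antidiagonal.1 p.2], Finset.prod_const,
      inv_pow_eq_pow_inv (by simp)]
    simp
  rw [hn]
  exact hasProd_fintype _

theorem hasSum_planePartitionSeries :
    HasSum (fun π : PlanePartition ↦ (X : K⟦X⟧) ^ π.boxes) (planePartitionSeries K) := by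
  rw [WithPiTopology.hasSum_iff_hasSum_coeff]
  intro n
  have hn : ∀ π ∉ (finite_setOf_boxes_eq n).toFinset, coeff n ((X : K⟦X⟧) ^ π.boxes) = 0 := by
    intro π hπ
    rw [coeff_X_pow, if_neg fun h ↦ hπ (by simp [h])]
  have h : coeff n (planePartitionSeries K) =
      ∑ π ∈ (finite_setOf_boxes_eq n).toFinset, coeff n ((X : K⟦X⟧) ^ π.boxes) := by
    rw [planePartitionSeries, coeff_mk, planePartitionCount, Finset.sum_congr rfl (g := fun _ ↦ 1)]
    · rw [Finset.sum_const, nsmul_one, ← Nat.card_eq_card_finite_toFinset]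
      rfl
    · intro π hπ
      rw [coeff_X_pow, if_pos]
      simpa [eq_comm] using hπ
  rw [h]
  exact hasSum_sum_of_ne_finset_zero hn

theorem planePartitionCount_values :
    planePartitionCount 0 = 1 ∧ planePartitionCount 1 = 1 ∧
    planePartitionCount 2 = 3 ∧ planePartitionCount 3 = 6 := by
  have hG {k : ℕ} (hk : k ≤ 3) := coeff_prod_square ℚ hk
  set G := ∏ p ∈ Finset.range 3 ×ˢ Finset.range 3, (1 - (X : ℚ⟦X⟧) ^ (p.1 + p.2 + 1))⁻¹ with hGdef
  have h1 : G * ∏ p ∈ Finset.range 3 ×ˢ Finset.range 3, (1 - (X : ℚ⟦X⟧) ^ (p.1 + p.2 + 1)) = 1 := by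
    rw [hGdef, ← Finset.prod_mul_distrib]
    exact Finset.prod_eq_one fun p _ ↦ PowerSeries.inv_mul_cancel _ (by simp)
  -- The square of side 3 determines the coefficients up to 3. Everything from degree 4 on goes into
  -- `R`, leaving the recurrence p_n = p_(n-1) + 2 p_(n-2) + p_(n-3) for 1 ≤ n ≤ 3, with p_k = 0 for
  -- k < 0.
  obtain ⟨R, h2⟩ : ∃ R, ∏ p ∈ Finset.range 3 ×ˢ Finset.range 3,
      (1 - (X : ℚ⟦X⟧) ^ (p.1 + p.2 + 1)) = 1 - X ^ 1 - 2 * X ^ 2 - X ^ 3 + R * X ^ 4 := by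
    refine ⟨2 + 6 * X + 2 * X ^ 2 - 2 * X ^ 3 - 9 * X ^ 4 - 8 * X ^ 5 + X ^ 6 + 9 * X ^ 7 +
      12 * X ^ 8 + 4 * X ^ 9 - 4 * X ^ 10 - 12 * X ^ 11 - 9 * X ^ 12 - X ^ 13 + 8 * X ^ 14 +
      9 * X ^ 15 + 2 * X ^ 16 - 2 * X ^ 17 - 6 * X ^ 18 - 2 * X ^ 19 + X ^ 20 + 2 * X ^ 21 +
      X ^ 22 - X ^ 23, ?_⟩
    simp only [Finset.prod_product, Finset.prod_range_succ, Finset.prod_range_zero]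
    ring
  -- The term 2 G X^2 is split so that every summand is a multiple of a pure power of `X`, as
  -- `coeff_mul_X_pow'` expects.
  have h3 : G = 1 + G * X ^ 1 + (G * X ^ 2 + G * X ^ 2) + G * X ^ 3 - G * R * X ^ 4 := by
    rw [h2] at h1
    linear_combination h1
  have key (n : ℕ) := congrArg (coeff n) h3
  simp only [map_add, map_sub, coeff_mul_X_pow', coeff_one] at key
  have h0 := key 0
  have h1 := key 1
  have h2 := key 2
  have h3 := key 3
  norm_num [hG] at h0 h1 h2 h3
  rw [h0] at h1 h2 h3
  rw [h1] at h2 h3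
  norm_num at h2
  rw [h2] at h3
  norm_num at h3
  exact_mod_cast And.intro h0 (And.intro h1 (And.intro h2 h3))

end PlanePartition

theorem mainTheorem1 (K : Type*) [Field K] [TopologicalSpace K] [DiscreteTopology K] :
    (∀ n : ℕ, {π : PlanePartition | π.boxes = n}.Finite) ∧
    HasSum (fun π : PlanePartition ↦ (PowerSeries.X : K⟦X⟧) ^ π.boxes)
      (planePartitionSeries K) ∧
    HasProd (fun n : ℕ ↦ ((1 - (PowerSeries.X : K⟦X⟧) ^ (n + 1)) ^ (n + 1))⁻¹)
      (planePartitionSeries K) ∧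
    planePartitionCount 0 = 1 ∧ planePartitionCount 1 = 1 ∧
    planePartitionCount 2 = 3 ∧ planePartitionCount 3 = 6 := by
  exact ⟨PlanePartition.finite_setOf_boxes_eq, PlanePartition.hasSum_planePartitionSeries K,
    PlanePartition.hasProd_planePartitionSeries K, PlanePartition.planePartitionCount_values⟩
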